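/- Let $n \ge 1$. An affine map of $\mathbb{C}^n$ is a map $f(x) = Ax + a$ with $A \in M_n(\mathbb{C})$ (not necessarily invertible) and $a \in \mathbb{C}^n$. Let $\mathcal{G}$ be a semigroup, under composition, generated by $n$ affine maps $f_1,\dots,f_n$ of $\mathbb{C}^n$, and suppose that $\mathcal{G}$ is abelian. Then $\mathcal{G}$ is not locally hypercyclic: for every $x \in \mathbb{C}^n$, the closure of the orbit $\{g(x) : g \in \mathcal{G}\}$ has empty interior in $\mathbb{C}^n$. -/

import Mathlib

namespace AffineDynamics

/-- Affine self-maps `x ↦ A x + a` of `ℂⁿ`, a monoid under composition. -/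
abbrev AffineSelfMap (n : ℕ) : Type :=
  EuclideanSpace ℂ (Fin n) →ᵃ[ℂ] EuclideanSpace ℂ (Fin n)

/-- The orbit `{g x : g ∈ S}` of `x` under a semigroup `S` of affine maps of `ℂⁿ`. -/
def orbit {n : ℕ} (S : Subsemigroup (AffineSelfMap n)) (x : EuclideanSpace ℂ (Fin n)) :
    Set (EuclideanSpace ℂ (Fin n)) :=
  {y | ∃ g ∈ S, g x = y}

/-- `S` is locally hypercyclic: the closure of some orbit has non-empty interior. -/
def IsLocallyHypercyclic {n : ℕ} (S : Subsemigroup (AffineSelfMap n)) : Prop :=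
  ∃ x : EuclideanSpace ℂ (Fin n), (interior (closure (orbit S x))).Nonempty

end AffineDynamics

open Topology NormedSpace

namespace AffineDynamics

/-! ### Exponential of a commutative Banach algebra -/

section Exponential

variable {A : Type*} [NormedCommRing A] [NormedAlgebra ℂ A] [CompleteSpace A]

/-! By commutativity, a word containing a non-surjective generator has its range in that generator's
proper affine image; finitely many such images are nowhere dense. The invertible generators
linearize on `ℂ × V`, of dimension `n + 1`, where an orbit somewhere dense would give a cone orbit
somewhere dense (`interior_closure_cone_orbit_eq_empty`). Evaluation at the base vector then
identifies the commutative algebra `A` they generate with the whole space.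

In `A` units have logarithms (`exists_exp_eq`), so the logarithms of the cone lie in the group
generated by `n` vectors, plus `ℂ · 1`, plus the kernel of `exp`. By Liouville that kernel spans
real dimension at most `n + 1`. Modulo it and `ℂ · 1`, real dimension at least `n` remains, where
`n` vectors generate no somewhere dense group. -/

theorem exp_add_complex (x y : A) : exp (x + y) = exp x * exp y := by
  let _ := NormedAlgebra.restrictScalars ℚ ℂ A
  exact exp_add_of_commute (Commute.all x y)

theorem isUnit_exp_complex (x : A) : IsUnit (exp x) := by
  let _ := NormedAlgebra.restrictScalars ℚ ℂ A
  exact isUnit_exp x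

theorem exp_neg_mul_exp (x : A) : exp (-x) * exp x = 1 := by
  rw [← exp_add_complex, neg_add_cancel, exp_zero]

theorem map_exp_nhds_zero : Filter.map (exp : A → A) (𝓝 0) = 𝓝 1 := by
  have h := (hasStrictFDerivAt_exp_zero (𝕂 := ℂ) (𝔸 := A))
  have := HasStrictFDerivAt.map_nhds_eq_of_equiv (f' := ContinuousLinearEquiv.refl ℂ A) h
  simpa using this

theorem isOpenMap_exp : IsOpenMap (exp : A → A) := by
  rw [isOpenMap_iff_nhds_le]
  intro x
  have hu := isUnit_exp_complex x
  have h1 : Filter.map (fun y : A => exp x * y) (𝓝 1) = 𝓝 (exp x) := by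
    have h := (Homeomorph.smul (α := A) hu.unit).map_nhds_eq 1
    have h1 : Homeomorph.smul (α := A) hu.unit 1 = exp x := mul_one _
    rwa [h1] at h
  have h2 : Filter.map (fun y : A => x + y) (𝓝 0) = 𝓝 x := by
    simp
  rw [← h1, ← map_exp_nhds_zero, ← h2, Filter.map_map, Filter.map_map]
  apply le_of_eq
  congr 1
  funext y
  simp [exp_add_complex]

theorem continuous_exp_complex : Continuous (exp : A → A) := by
  let _ := NormedAlgebra.restrictScalars ℚ ℂ A
  exact exp_continuous

variable [FiniteDimensional ℂ A]

omit [CompleteSpace A] in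
theorem finite_setOf_not_isUnit_lineMap (a : A) :
    {z : ℂ | ¬ IsUnit (1 + z • (a - 1))}.Finite := by
  have hfin : (spectrum ℂ (a - 1)).Finite := by
    have h := Module.End.finite_spectrum (Algebra.lmul ℂ A (a - 1))
    refine h.subset ?_
    intro z hz hz'
    apply hz
    have := (Module.End.isUnit_iff _).1 hz'
    have hs := this.2 1
    obtain ⟨b, hb⟩ := hs
    refine IsUnit.of_mul_eq_one b ?_
    simpa [sub_mul, Algebra.smul_def] using hb
  refine (hfin.image (fun z => - z⁻¹)).subset ?_
  intro z hz
  have hz0 : z ≠ 0 := by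
    rintro rfl
    simp at hz
  refine ⟨- z⁻¹, ?_, by simp⟩
  intro h
  apply hz
  have : 1 + z • (a - 1) = algebraMap ℂ A (-z) * (algebraMap ℂ A (-z⁻¹) - (a - 1)) := by
    rw [mul_sub, ← map_mul, Algebra.smul_def]
    simp [hz0]
  rw [this]
  exact ((isUnit_iff_ne_zero.2 (neg_ne_zero.2 hz0)).map (algebraMap ℂ A)).mul h

/-- The range of `exp` is an open subgroup of the units, so its complement in the units is a union
of open cosets. The complex line through `1` and `a`, minus its finitely many non-units, is
connected and cannot meet both. -/
theorem exists_exp_eq {a : A} (ha : IsUnit a) : ∃ L : A, exp L = a := by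
  set s : Set ℂ := {z : ℂ | ¬ IsUnit (1 + z • (a - 1))} with hs
  have hconn : IsConnected sᶜ :=
    (finite_setOf_not_isUnit_lineMap a).countable.isConnected_compl_of_one_lt_rank (by simp)
  have hg : Continuous (fun z : ℂ => 1 + z • (a - 1)) := by fun_prop
  set R : Set A := Set.range (exp : A → A) with hR
  have hRo : IsOpen R := isOpenMap_exp.isOpen_range
  set T : Set A := {x | IsUnit x ∧ x ∉ R} with hT
  have hTo : IsOpen T := by
    rw [isOpen_iff_mem_nhds]
    rintro x ⟨hx, hxR⟩
    have hopen : IsOpen ((fun y => x * y) '' R) := (Homeomorph.smul hx.unit).isOpenMap _ hRo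
    refine Filter.mem_of_superset (hopen.mem_nhds ⟨1, ⟨0, exp_zero⟩, mul_one x⟩) ?_
    rintro _ ⟨_, ⟨y, rfl⟩, rfl⟩
    refine ⟨hx.mul (isUnit_exp_complex y), ?_⟩
    rintro ⟨z, hz⟩
    apply hxR
    refine ⟨z + -y, ?_⟩
    rw [exp_add_complex, hz, mul_assoc, mul_comm (exp y), exp_neg_mul_exp, mul_one]
  by_contra hcon
  have h := hconn.isPreconnected _ _ (hRo.preimage hg) (hTo.preimage hg) ?_ ?_ ?_
  · obtain ⟨z, -, h1, h2⟩ := h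
    exact h2.2 h1
  · intro z hz
    by_cases hzR : 1 + z • (a - 1) ∈ R
    · exact Or.inl hzR
    · exact Or.inr ⟨not_not.1 hz, hzR⟩
  · exact ⟨0, by simp [hs], 0, by simp⟩
  · refine ⟨1, by simpa [hs] using ha, ?_⟩
    refine ⟨by simpa using ha, ?_⟩
    rintro ⟨L, hL⟩
    exact hcon ⟨L, by simpa using hL⟩

end Exponential

/-! ### Groups generated by few vectors -/

/-- Either the vectors span a proper closed subspace, or they form a basis and generate a lattice,
which is closed and countable. -/
theorem interior_closure_addSubgroup_closure_eq_empty {E ι : Type*} [NormedAddCommGroup E]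
    [NormedSpace ℝ E] [FiniteDimensional ℝ E] [Fintype ι] (v : ι → E)
    (hcard : Fintype.card ι ≤ Module.finrank ℝ E) (hpos : 0 < Module.finrank ℝ E) :
    interior (closure (AddSubgroup.closure (Set.range v) : Set E)) = ∅ := by
  by_contra hne
  have hne := Set.nonempty_iff_ne_empty.2 hne
  have hsub : (AddSubgroup.closure (Set.range v) : Set E) ⊆ Submodule.span ℝ (Set.range v) := by
    have : AddSubgroup.closure (Set.range v) ≤ (Submodule.span ℝ (Set.range v)).toAddSubgroup :=
      (AddSubgroup.closure_le _).2 Submodule.subset_span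
    exact this
  have hcl : closure (AddSubgroup.closure (Set.range v) : Set E) ⊆
      Submodule.span ℝ (Set.range v) :=
    closure_minimal hsub (Submodule.closed_of_finiteDimensional _)
  have htop : Submodule.span ℝ (Set.range v) = ⊤ :=
    Submodule.eq_top_of_nonempty_interior' _ (hne.mono (interior_mono hcl))
  have hcard' : Fintype.card ι = Module.finrank ℝ E :=
    le_antisymm hcard (by
      have := finrank_range_le_card (R := ℝ) v
      rwa [Set.finrank, htop, finrank_top] at this)
  have hli : LinearIndependent ℝ v :=
    linearIndependent_of_top_le_span_of_card_eq_finrank htop.ge hcard'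
  let b := Module.Basis.mk hli htop.ge
  have hb : AddSubgroup.closure (Set.range v) =
      (Submodule.span ℤ (Set.range b)).toAddSubgroup := by
    rw [Submodule.span_int_eq_addSubgroupClosure, Module.Basis.coe_mk]
  have hdisc : DiscreteTopology (Submodule.span ℤ (Set.range b)).toAddSubgroup := inferInstance
  rw [hb, (AddSubgroup.isClosed_of_discrete).closure_eq] at hne
  have : Nontrivial E := Module.finrank_pos_iff.1 hpos
  have hcount : ((Submodule.span ℤ (Set.range b)).toAddSubgroup : Set E).Countable := by
    have : Countable (Submodule.span ℤ (Set.range b)).toAddSubgroup :=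
      TopologicalSpace.separableSpace_iff_countable.1 inferInstance
    exact Set.to_countable _
  have hd := hcount.dense_compl ℝ
  rw [← interior_eq_empty_iff_dense_compl] at hd
  exact hne.ne_empty hd

/-! ### The kernel of the exponential -/

section Kernel

variable {A : Type*} [NormedCommRing A] [NormedAlgebra ℂ A] [CompleteSpace A]

theorem exists_norm_exp_smul_le {x : A} (hx : x ∈ Submodule.span ℝ {y : A | exp y = 1}) :
    ∃ C : ℝ, ∀ t : ℝ, ‖exp (t • x)‖ ≤ C := by
  induction hx using Submodule.span_induction with
  | mem x hx =>
    have hcont : Continuous (fun t : ℝ => exp (t • x)) :=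
      continuous_exp_complex.comp (by fun_prop)
    have hper : Function.Periodic (fun t : ℝ => exp (t • x)) 1 := by
      intro t
      have hx : exp x = 1 := hx
      simp [add_smul, exp_add_complex, hx]
    obtain ⟨C, hC⟩ := (isCompact_Icc (a := (0 : ℝ)) (b := 1)).exists_bound_of_continuousOn
      hcont.continuousOn
    refine ⟨C, fun t => ?_⟩
    obtain ⟨s, hs, hts⟩ := hper.exists_mem_Ico₀ one_pos t
    have := hC s ⟨hs.1, hs.2.le⟩
    change exp (t • x) = exp (s • x) at hts
    rwa [hts]
  | zero => exact ⟨‖exp (0 : A)‖, fun t => by simp⟩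
  | add x y _ _ ihx ihy =>
    obtain ⟨C, hC⟩ := ihx
    obtain ⟨D, hD⟩ := ihy
    refine ⟨C * D, fun t => ?_⟩
    rw [smul_add, exp_add_complex]
    exact (norm_mul_le _ _).trans
      (mul_le_mul (hC t) (hD t) (norm_nonneg _) ((norm_nonneg _).trans (hC t)))
  | smul r x _ ih =>
    obtain ⟨C, hC⟩ := ih
    exact ⟨C, fun t => by rw [smul_smul]; exact hC _⟩

/-- Liouville: `z ↦ exp (z • x)` is entire and bounded, hence constant, and its derivative at `0` is
`x`. -/
theorem eq_zero_of_mem_span_of_I_smul_mem_span {x : A}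
    (hx : x ∈ Submodule.span ℝ {y : A | exp y = 1})
    (hIx : Complex.I • x ∈ Submodule.span ℝ {y : A | exp y = 1}) : x = 0 := by
  obtain ⟨C, hC⟩ := exists_norm_exp_smul_le hx
  obtain ⟨D, hD⟩ := exists_norm_exp_smul_le hIx
  have hder : ∀ z : ℂ, HasDerivAt (fun z : ℂ => exp (z • x)) (exp (z • x) * x) z :=
    fun z => hasDerivAt_exp_smul_const x z
  have hdiff : Differentiable ℂ (fun z : ℂ => exp (z • x)) := fun z => (hder z).differentiableAt
  have hbdd : Bornology.IsBounded (Set.range (fun z : ℂ => exp (z • x))) := by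
    rw [isBounded_iff_forall_norm_le]
    refine ⟨C * D, ?_⟩
    rintro _ ⟨z, rfl⟩
    have hz : z • x = z.re • x + z.im • (Complex.I • x) := by
      conv_lhs => rw [← Complex.re_add_im z, add_smul, mul_smul]
      rfl
    simp only
    rw [hz, exp_add_complex]
    exact (norm_mul_le _ _).trans
      (mul_le_mul (hC _) (hD _) (norm_nonneg _) ((norm_nonneg _).trans (hC 0)))
  have hconst : (fun z : ℂ => exp (z • x)) = fun _ => exp ((0 : ℂ) • x) := by
    funext z
    exact hdiff.apply_eq_apply_of_bounded hbdd z 0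
  have h0 := hder 0
  rw [hconst] at h0
  have := h0.unique (hasDerivAt_const _ _)
  simpa using this

variable [FiniteDimensional ℂ A]

theorem finrank_span_exp_eq_one_le :
    Module.finrank ℝ (Submodule.span ℝ {y : A | exp y = 1}) ≤ Module.finrank ℂ A := by
  have : FiniteDimensional ℝ A := FiniteDimensional.complexToReal A
  set H := Submodule.span ℝ {y : A | exp y = 1}
  let J : A ≃ₗ[ℝ] A :=
    (LinearEquiv.smulOfNeZero ℂ A Complex.I Complex.I_ne_zero).restrictScalars ℝ
  have hdisj : H ⊓ H.comap J.toLinearMap = ⊥ := by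
    rw [eq_bot_iff]
    rintro x ⟨hx, hx'⟩
    exact eq_zero_of_mem_span_of_I_smul_mem_span hx hx'
  have hJ : Module.finrank ℝ (H.comap J.toLinearMap) = Module.finrank ℝ H := by
    rw [Submodule.comap_equiv_eq_map_symm]
    exact LinearEquiv.finrank_map_eq _ _
  have h1 := Submodule.finrank_sup_add_finrank_inf_eq H (H.comap J.toLinearMap)
  have h2 := Submodule.finrank_le (H ⊔ H.comap J.toLinearMap)
  rw [hdisj, finrank_bot, hJ] at h1
  rw [finrank_real_of_complex] at h2
  omega

/-- The cone over the monoid generated by `n` units of a commutative algebra of dimension `n + 1`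
is nowhere dense. -/
theorem interior_closure_cone_eq_empty {n : ℕ} (hn : 1 ≤ n)
    (hdim : Module.finrank ℂ A = n + 1) (F : Fin n → A) (hF : ∀ i, IsUnit (F i)) :
    interior (closure {x : A | ∃ c : ℂ, c ≠ 0 ∧ ∃ g ∈ Submonoid.closure (Set.range F),
      x = c • g}) = ∅ := by
  by_contra hne
  have hne := Set.nonempty_iff_ne_empty.2 hne
  have : FiniteDimensional ℝ A := FiniteDimensional.complexToReal A
  set D : Set A := {x : A | ∃ c : ℂ, c ≠ 0 ∧ ∃ g ∈ Submonoid.closure (Set.range F), x = c • g}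
  choose L hL using fun i => exists_exp_eq (hF i)
  have hlog : ∀ g ∈ Submonoid.closure (Set.range F),
      ∃ Y ∈ AddSubgroup.closure (Set.range L), exp Y = g := by
    intro g hg
    induction hg using Submonoid.closure_induction with
    | mem x hx =>
      obtain ⟨i, rfl⟩ := hx
      exact ⟨L i, AddSubgroup.subset_closure ⟨i, rfl⟩, hL i⟩
    | one => exact ⟨0, zero_mem _, exp_zero⟩
    | mul x y _ _ hx hy =>
      obtain ⟨X, hX, rfl⟩ := hx
      obtain ⟨Y, hY, rfl⟩ := hy
      exact ⟨X + Y, add_mem hX hY, exp_add_complex X Y⟩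
  have hscal : ∀ c : ℂ, exp (algebraMap ℂ A c) = algebraMap ℂ A (Complex.exp c) := by
    intro c
    rw [Complex.exp_eq_exp_ℂ]
    exact (algebraMap_exp_comm c).symm
  set H := Submodule.span ℝ {y : A | exp y = 1} with hH
  -- Since `2πi` already lies in `H`, one real line suffices to capture all of `ℂ · 1`. The
  -- dimension thus saved leaves `2(n + 1) - (n + 2) = n` in the quotient.
  set P := H ⊔ Submodule.span ℝ {(1 : A)} with hP
  have hscalP : ∀ c : ℂ, algebraMap ℂ A c ∈ P := by
    intro c
    have h1 : algebraMap ℂ A (2 * Real.pi * Complex.I) ∈ H :=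
      Submodule.subset_span (by
        change exp _ = 1
        rw [hscal, Complex.exp_two_pi_mul_I, map_one])
    have h2 : algebraMap ℂ A c =
        (c.im / (2 * Real.pi)) • algebraMap ℂ A (2 * Real.pi * Complex.I) + c.re • (1 : A) := by
      have hpi : (Real.pi : ℂ) ≠ 0 := by exact_mod_cast Real.pi_ne_zero
      rw [← Complex.coe_smul, ← Complex.coe_smul, Algebra.smul_def, ← map_mul,
        Algebra.smul_def, mul_one, ← map_add]
      congr 1
      conv_lhs => rw [← Complex.re_add_im c]
      push_cast
      field_simp
      ring
    rw [h2]
    exact add_mem (P.smul_mem _ (Submodule.mem_sup_left h1))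
      (P.smul_mem _ (Submodule.mem_sup_right (Submodule.mem_span_singleton_self _)))
  have hPdim : Module.finrank ℝ P ≤ n + 2 := by
    have h1 := Submodule.finrank_add_le_finrank_add_finrank H (Submodule.span ℝ {(1 : A)})
    have h2 : Module.finrank ℝ H ≤ Module.finrank ℂ A := finrank_span_exp_eq_one_le
    have h3 : Module.finrank ℝ (Submodule.span ℝ {(1 : A)}) ≤ 1 := by
      simpa using finrank_span_le_card (R := ℝ) ({(1 : A)} : Set A)
    rw [hP]
    omega
  have hQ := Submodule.finrank_quotient_add_finrank P
  rw [finrank_real_of_complex, hdim] at hQ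
  let e := (Module.finBasis ℝ (A ⧸ P)).equivFun
  let ρ : A →ₗ[ℝ] (Fin (Module.finrank ℝ (A ⧸ P)) → ℝ) := e.toLinearMap ∘ₗ P.mkQ
  have hρ : Function.Surjective ρ := e.surjective.comp P.mkQ_surjective
  have hρP : ∀ x ∈ P, ρ x = 0 := by
    intro x hx
    simp [ρ, (Submodule.Quotient.mk_eq_zero P).2 hx]
  have hlat := interior_closure_addSubgroup_closure_eq_empty (fun i => ρ (L i))
    (by simp; omega) (by simp; omega)
  have himage : ρ '' (exp ⁻¹' D) ⊆ AddSubgroup.closure (Set.range fun i => ρ (L i)) := by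
    rintro _ ⟨X, ⟨c, hc, g, hg, hX⟩, rfl⟩
    obtain ⟨Y, hY, rfl⟩ := hlog g hg
    have hYρ : ρ Y ∈ AddSubgroup.closure (Set.range fun i => ρ (L i)) := by
      have := AddSubgroup.mem_map_of_mem ρ.toAddMonoidHom hY
      rwa [AddMonoidHom.map_closure, ← Set.range_comp] at this
    have hXP : X - Y ∈ P := by
      have hk : X - Y - algebraMap ℂ A (Complex.log c) ∈ P := by
        refine Submodule.mem_sup_left (Submodule.subset_span ?_)
        have h : X = (X - Y - algebraMap ℂ A (Complex.log c)) +
            (Y + algebraMap ℂ A (Complex.log c)) := by ring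
        have hu := isUnit_exp_complex (Y + algebraMap ℂ A (Complex.log c))
        change exp _ = 1
        apply hu.mul_right_cancel
        rw [← exp_add_complex, ← h, hX, one_mul, exp_add_complex, hscal, Complex.exp_log hc,
          Algebra.smul_def, mul_comm]
      simpa using add_mem hk (hscalP (Complex.log c))
    have := hρP _ hXP
    rw [map_sub, sub_eq_zero] at this
    rw [this]
    exact hYρ
  have hopen : IsOpen (ρ '' (exp ⁻¹' interior (closure D))) :=
    ρ.isOpenMap_of_finiteDimensional hρ _ (isOpen_interior.preimage continuous_exp_complex)
  have hsub : ρ '' (exp ⁻¹' interior (closure D)) ⊆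
      closure (AddSubgroup.closure (Set.range fun i => ρ (L i))) :=
    calc ρ '' (exp ⁻¹' interior (closure D)) ⊆ ρ '' (exp ⁻¹' closure D) :=
          Set.image_mono (Set.preimage_mono interior_subset)
      -- Openness of `exp` carries density up to the logarithms.
      _ ⊆ ρ '' closure (exp ⁻¹' D) :=
          Set.image_mono isOpenMap_exp.preimage_closure_subset_closure_preimage
      _ ⊆ closure (ρ '' (exp ⁻¹' D)) :=
          image_closure_subset_closure_image ρ.continuous_of_finiteDimensional
      _ ⊆ _ := closure_mono himage
  have hmem : (ρ '' (exp ⁻¹' interior (closure D))).Nonempty := by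
    obtain ⟨y, hy⟩ := hne
    obtain ⟨x, hx, c, hc, g, hg, rfl⟩ :=
      mem_closure_iff.1 (interior_subset hy) _ isOpen_interior hy
    obtain ⟨Y, -, rfl⟩ := hlog g hg
    refine ⟨_, Set.mem_image_of_mem ρ (x := algebraMap ℂ A (Complex.log c) + Y) ?_⟩
    rwa [Set.mem_preimage, exp_add_complex, hscal, Complex.exp_log hc, ← Algebra.smul_def]
  exact (hmem.mono (interior_maximal hsub hopen)).ne_empty hlat

end Kernel

/-! ### From operators to the algebra they generate -/

/-- A commuting family of `n` invertible operators on a space of dimension `n + 1` is nowhere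
supercyclic. -/
theorem interior_closure_cone_orbit_eq_empty {W : Type*} [NormedAddCommGroup W] [NormedSpace ℂ W]
    [FiniteDimensional ℂ W] {n : ℕ} (hn : 1 ≤ n) (hdim : Module.finrank ℂ W = n + 1)
    (F : Fin n → W →L[ℂ] W) (hcomm : ∀ i j, F i * F j = F j * F i) (hF : ∀ i, IsUnit (F i))
    (w : W) :
    interior (closure {x : W | ∃ c : ℂ, c ≠ 0 ∧ ∃ g ∈ Submonoid.closure (Set.range F),
      x = c • g w}) = ∅ := by
  by_contra hne
  have hne := Set.nonempty_iff_ne_empty.2 hne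
  set A : Subalgebra ℂ (W →L[ℂ] W) := Algebra.adjoin ℂ (Set.range F) with hA
  have hmul : ∀ a b : A, a * b = b * a := by
    have := Algebra.isMulCommutative_adjoin ℂ (s := Set.range F)
      (by rintro _ ⟨i, rfl⟩ _ ⟨j, rfl⟩; exact hcomm i j)
    exact fun a b => mul_comm' a b
  let _ : NormedCommRing A := { (inferInstance : NormedRing A) with mul_comm := hmul }
  have hmem : ∀ i, F i ∈ A := fun i => Algebra.subset_adjoin ⟨i, rfl⟩
  let G : Fin n → A := fun i => ⟨F i, hmem i⟩
  let ev : A →ₗ[ℂ] W :=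
    { toFun := fun a => (a : W →L[ℂ] W) w
      map_add' := fun _ _ => rfl
      map_smul' := fun _ _ => rfl }
  have hmap : Submonoid.closure (Set.range F) =
      (Submonoid.closure (Set.range G)).map A.val.toRingHom.toMonoidHom := by
    rw [MonoidHom.map_mclosure, ← Set.range_comp]
    rfl
  have himage : {x : W | ∃ c : ℂ, c ≠ 0 ∧ ∃ g ∈ Submonoid.closure (Set.range F), x = c • g w} =
      ev '' {x : A | ∃ c : ℂ, c ≠ 0 ∧ ∃ g ∈ Submonoid.closure (Set.range G), x = c • g} := by
    rw [hmap]
    ext x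
    constructor
    · rintro ⟨c, hc, _, ⟨g, hg, rfl⟩, rfl⟩
      exact ⟨c • g, ⟨c, hc, g, hg, rfl⟩, rfl⟩
    · rintro ⟨_, ⟨c, hc, g, hg, rfl⟩, rfl⟩
      exact ⟨c, hc, _, ⟨g, hg, rfl⟩, rfl⟩
  rw [himage] at hne
  have hsurj : Function.Surjective ev := by
    rw [← LinearMap.range_eq_top]
    refine Submodule.eq_top_of_nonempty_interior' _ (hne.mono (interior_mono ?_))
    exact closure_minimal (Set.image_subset_range _ _) (Submodule.closed_of_finiteDimensional _)
  -- If `a` kills `w`, it kills every `b w`, and these fill `W`.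
  have hinj : Function.Injective ev := by
    rw [injective_iff_map_eq_zero]
    intro a ha
    ext v
    obtain ⟨b, rfl⟩ := hsurj v
    change ((a * b : A) : W →L[ℂ] W) w = 0
    rw [hmul]
    change (b : W →L[ℂ] W) ((a : W →L[ℂ] W) w) = 0
    have ha : (a : W →L[ℂ] W) w = 0 := ha
    rw [ha, map_zero]
  let e : A ≃ₗ[ℂ] W := LinearEquiv.ofBijective ev ⟨hinj, hsurj⟩
  let E : A ≃L[ℂ] W := e.toContinuousLinearEquiv
  have hAdim : Module.finrank ℂ A = n + 1 := by rw [e.finrank_eq, hdim]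
  -- The inverse must be found inside `A`: injective multiplication on a finite-dimensional algebra
  -- is surjective.
  have hG : ∀ i, IsUnit (G i) := by
    intro i
    have hinjG : Function.Injective (LinearMap.mulLeft ℂ (G i)) := by
      rw [injective_iff_map_eq_zero]
      intro b hb
      have hb : F i * (b : W →L[ℂ] W) = 0 := congrArg Subtype.val hb
      exact Subtype.ext ((hF i).mul_right_eq_zero.1 hb)
    obtain ⟨b, hb⟩ := LinearMap.injective_iff_surjective.1 hinjG 1
    exact IsUnit.of_mul_eq_one b hb
  have hempty := interior_closure_cone_eq_empty hn hAdim G hG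
  have h := E.toHomeomorph.image_interior
    (closure {x : A | ∃ c : ℂ, c ≠ 0 ∧ ∃ g ∈ Submonoid.closure (Set.range G), x = c • g})
  rw [E.toHomeomorph.image_closure, hempty, Set.image_empty] at h
  exact hne.ne_empty h.symm

/-! ### Affine maps and their linearization -/

section Affine

variable {V : Type*} [NormedAddCommGroup V] [NormedSpace ℂ V] [FiniteDimensional ℂ V]

/-- The linearization `(t, v) ↦ (t, A v + t a)` of the affine map `v ↦ A v + a`. -/
noncomputable def linearization : (V →ᵃ[ℂ] V) →* (ℂ × V →L[ℂ] ℂ × V) where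
  toFun f := LinearMap.toContinuousLinearMap
    { toFun := fun p => (p.1, f.linear p.2 + p.1 • f 0)
      map_add' := fun p q => by
        ext
        · rfl
        · simp [add_smul]
          abel
      map_smul' := fun c p => by
        ext
        · rfl
        · simp [mul_smul] }
  map_one' := by
    ext p
    · rfl
    · simp
    · rfl
    · simp
      rfl
  map_mul' f g := by
    have h : f (g 0) = f.linear (g 0) + f 0 := by
      conv_lhs => rw [AffineMap.decomp f]
      rfl
    ext p
    · rfl
    · simp [h]
    · rfl
    · simp
      rfl

@[simp]
theorem linearization_apply (f : V →ᵃ[ℂ] V) (p : ℂ × V) :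
    linearization f p = (p.1, f.linear p.2 + p.1 • f 0) := rfl

theorem linearization_one_apply (f : V →ᵃ[ℂ] V) (v : V) :
    linearization f (1, v) = (1, f v) := by
  have h : f v = f.linear v + f 0 := by
    conv_lhs => rw [AffineMap.decomp f]
    rfl
  simp [h]

theorem isUnit_affineMap_of_surjective {f : V →ᵃ[ℂ] V} (hf : Function.Surjective f) :
    IsUnit f := by
  have hs : Function.Surjective f.linear := (AffineMap.linear_surjective_iff f).2 hf
  have hi : Function.Injective f.linear := LinearMap.injective_iff_surjective.2 hs
  let e := AffineEquiv.ofBijective ⟨(AffineMap.linear_injective_iff f).1 hi, hf⟩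
  refine ⟨⟨f, e.symm.toAffineMap, ?_, ?_⟩, rfl⟩
  · ext x
    exact e.apply_symm_apply x
  · ext x
    exact e.symm_apply_apply x

theorem interior_closure_submonoid_orbit_eq_empty {n : ℕ} (hn : 1 ≤ n)
    (hdim : Module.finrank ℂ V = n) (f : Fin n → V →ᵃ[ℂ] V)
    (hcomm : ∀ i j, f i * f j = f j * f i) (hf : ∀ i, IsUnit (f i)) (x : V) :
    interior (closure {y : V | ∃ g ∈ Submonoid.closure (Set.range f), g x = y}) = ∅ := by
  by_contra hne
  obtain ⟨y₀, hy₀⟩ := Set.nonempty_iff_ne_empty.2 hne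
  set O := {y : V | ∃ g ∈ Submonoid.closure (Set.range f), g x = y}
  have hempty := interior_closure_cone_orbit_eq_empty hn
    (W := ℂ × V) (by rw [Module.finrank_prod, hdim, Module.finrank_self, add_comm])
    (fun i => linearization (f i))
    (fun i j => by rw [← map_mul, hcomm, map_mul]) (fun i => (hf i).map linearization) (1, x)
  set D := {p : ℂ × V | ∃ c : ℂ, c ≠ 0 ∧
    ∃ g ∈ Submonoid.closure (Set.range fun i => linearization (f i)), p = c • g (1, x)}
  -- The open cone over `{1} × interior (closure O)`.
  let C : Set (ℂ × V) := {p | p.1 ≠ 0} ∩ (fun p : ℂ × V => p.1⁻¹ • p.2) ⁻¹' interior (closure O)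
  have hC : IsOpen C := by
    refine ContinuousOn.isOpen_inter_preimage ?_ ?_ isOpen_interior
    · exact (continuousOn_fst.inv₀ fun p hp => hp).smul continuousOn_snd
    · exact isOpen_ne_fun continuous_fst continuous_const
  have hCD : C ⊆ closure D := by
    rintro ⟨c, v⟩ ⟨hc, hv⟩
    have hc : c ≠ 0 := hc
    have hv : c⁻¹ • v ∈ closure O := interior_subset hv
    have hcont : Continuous (fun y : V => c • ((1 : ℂ), y)) := by fun_prop
    have hmaps : Set.MapsTo (fun y : V => c • ((1 : ℂ), y)) O D := by
      rintro _ ⟨g, hg, rfl⟩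
      refine ⟨c, hc, linearization g, ?_, by rw [linearization_one_apply]⟩
      have := Submonoid.mem_map_of_mem linearization hg
      rwa [MonoidHom.map_mclosure, ← Set.range_comp] at this
    have := hmaps.closure hcont hv
    simpa [smul_smul, hc] using this
  have hmem : ((1 : ℂ), y₀) ∈ C := ⟨one_ne_zero, by simpa using hy₀⟩
  have := interior_maximal hCD hC hmem
  rw [hempty] at this
  exact this

theorem interior_range_affineMap_eq_empty {f : V →ᵃ[ℂ] V} (hf : ¬ Function.Surjective f) :
    IsClosed (Set.range f) ∧ interior (Set.range f) = ∅ := by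
  have himage : Set.range f =
      Homeomorph.addRight (f 0) '' (LinearMap.range f.linear : Set V) := by
    rw [LinearMap.coe_range, ← Set.range_comp]
    congr 1
    conv_lhs => rw [AffineMap.decomp f]
    rfl
  rw [himage]
  refine ⟨(Homeomorph.addRight (f 0)).isClosedMap _ (Submodule.closed_of_finiteDimensional _), ?_⟩
  rw [← Homeomorph.image_interior, Set.image_eq_empty, ← Set.not_nonempty_iff_eq_empty]
  intro hne
  apply hf
  rw [← AffineMap.linear_surjective_iff, ← LinearMap.range_eq_top]
  exact Submodule.eq_top_of_nonempty_interior' _ hne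

end Affine

end AffineDynamics

/-! ### Reduction to invertible generators -/

open AffineDynamics in
theorem theorem1p1 (n : ℕ) (hn : 1 ≤ n)
    (S : Subsemigroup (AffineDynamics.AffineSelfMap n))
    (f : Fin n → AffineDynamics.AffineSelfMap n)
    (hgen : S = Subsemigroup.closure (Set.range f))
    (habelian : ∀ g ∈ S, ∀ h ∈ S, g * h = h * g) :
    ¬ AffineDynamics.IsLocallyHypercyclic S := by
  classical
  rintro ⟨x, hx⟩
  -- The identity as filler keeps exactly `n` commuting invertible maps.
  let f' : Fin n → AffineSelfMap n := fun i => if Function.Surjective (f i) then f i else 1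
  have hfS : ∀ i, f i ∈ S := fun i => hgen ▸ Subsemigroup.subset_closure ⟨i, rfl⟩
  have hcomm : ∀ i j, f' i * f' j = f' j * f' i := by
    intro i j
    have := habelian _ (hfS i) _ (hfS j)
    by_cases hi : Function.Surjective (f i) <;> by_cases hj : Function.Surjective (f j) <;>
      simp [f', hi, hj, this]
  have hunit : ∀ i, IsUnit (f' i) := by
    intro i
    by_cases hi : Function.Surjective (f i)
    · simpa [f', hi] using isUnit_affineMap_of_surjective hi
    · simp [f', hi]
  have hdich : ∀ g ∈ S, g ∈ Submonoid.closure (Set.range f') ∨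
      ∃ i, ¬ Function.Surjective (f i) ∧ Set.range g ⊆ Set.range (f i) := by
    intro g hg
    rw [hgen] at hg
    induction hg using Subsemigroup.closure_induction with
    | mem g hg =>
      obtain ⟨i, rfl⟩ := hg
      by_cases hi : Function.Surjective (f i)
      · exact Or.inl (Submonoid.subset_closure ⟨i, by simp [f', hi]⟩)
      · exact Or.inr ⟨i, hi, subset_rfl⟩
    | mul g h hgS hhS hg hh =>
      rcases hg with hg | ⟨i, hi, hg⟩
      · rcases hh with hh | ⟨i, hi, hh⟩
        · exact Or.inl (mul_mem hg hh)
        · refine Or.inr ⟨i, hi, ?_⟩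
          -- Commuting puts `h`, whose range is small, outermost.
          rw [habelian g (hgen ▸ hgS) h (hgen ▸ hhS)]
          exact (Set.range_comp_subset_range g h).trans hh
      · exact Or.inr ⟨i, hi, (Set.range_comp_subset_range h g).trans hg⟩
  let Z : Set (EuclideanSpace ℂ (Fin n)) :=
    ⋃ i ∈ {i | ¬ Function.Surjective (f i)}, Set.range (f i)
  have hfin : {i | ¬ Function.Surjective (f i)}.Finite := Set.toFinite _
  have hZ : IsClosed Z :=
    hfin.isClosed_biUnion fun i hi => (interior_range_affineMap_eq_empty hi).1
  have hZint : interior Z = ∅ := by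
    rw [interior_eq_empty_iff_dense_compl, Set.compl_iUnion₂]
    refine dense_biInter_of_isOpen
      (fun i hi => (interior_range_affineMap_eq_empty hi).1.isOpen_compl) hfin.countable
      fun i hi => ?_
    rw [← interior_eq_empty_iff_dense_compl]
    exact (interior_range_affineMap_eq_empty hi).2
  have hgood := interior_closure_submonoid_orbit_eq_empty hn (by simp) f' hcomm hunit x
  have hsub : orbit S x ⊆ {y | ∃ g ∈ Submonoid.closure (Set.range f'), g x = y} ∪ Z := by
    rintro _ ⟨g, hg, rfl⟩
    rcases hdich g hg with h | ⟨i, hi, h⟩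
    · exact Or.inl ⟨g, h, rfl⟩
    · exact Or.inr (Set.mem_biUnion hi (h ⟨x, rfl⟩))
  have hint := interior_mono (closure_mono hsub)
  rw [closure_union, hZ.closure_eq,
    interior_union_isClosed_of_interior_empty isClosed_closure hZint, hgood] at hint
  exact (hx.mono hint).ne_empty rfl
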